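/- A directed graph $G=(G^0,G^1,s_G,r_G)$ consists of a set $G^0$ of vertices, a set $G^1$ of edges and maps $s_G,r_G\colon G^1\to G^0$ (source and range); loops and multiple edges are allowed. The graph $C^*$-algebra $C^*(G)$ is the universal $C^*$-algebra generated by mutually orthogonal projections $p_v$ ($v\in G^0$) and partial isometries $s_e$ ($e\in G^1$) such that - $s_e^*s_f=0$ for $e\neq f$ in $G^1$, - $s_e^*s_e=p_{r_G(e)}$ and $s_es_e^*\le p_{s_G(e)}$ for all $e\in G^1$, - $p_v=\sum_{e\in s_G^{-1}(v)}s_es_e^*$ for every $v\in G^0$ with $0<|s_G^{-1}(v)|<\infty$. **Theorem.** Let $G$ be a directed graph and let $\alpha=\alpha_1\alpha_2\cdots\alpha_n$ ($n\ge 1$) be a path in $G$, i.e. $\alpha_1,\dots,\alpha_n\in G^1$ and $r_G(\alpha_i)=s_G(\alpha_{i+1})$ for $1\le i<n$; put $s_G(\alpha)=s_G(\alpha_1)$ and $r_G(\alpha)=r_G(\alpha_n)$. Let $E$ be the graph with vertex set $G^0$ and edge set $E^1=G^1\sqcup\{\alpha^m\mid m\in\mathbb N\}$, where the $\alpha^m$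 are pairwise distinct new edges, and whose range and source maps extend those of $G$ and satisfy $r_E(\alpha^m)=r_G(\alpha)$ and $s_E(\alpha^m)=s_G(\alpha)$ for all $m$. If $$\left|s_G^{-1}(s_G(\alpha_1))\cap r_G^{-1}(r_G(\alpha_1))\right|=\infty,$$ then $C^*(G)\cong C^*(E)$ as $C^*$-algebras. -/

import Mathlib

universe u v w

/-- A directed graph with vertex set `V` and edge set `E`; multiple edges and loops are allowed,
and both sets are arbitrary. -/
structure DirectedGraph (V : Type u) (E : Type v) where
  source : E → V
  range : E → V

namespace DirectedGraph

variable {V : Type u} {E : Type v}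

/-- A path `α = α₁ α₂ ⋯ αₙ` with `n = length + 1 ≥ 1` edges, where `r(αᵢ) = s(αᵢ₊₁)`;
the edge `αᵢ₊₁` is `edge i`. -/
structure Path (G : DirectedGraph V E) where
  length : ℕ
  edge : Fin (length + 1) → E
  range_eq_source : ∀ i : Fin length, G.range (edge i.castSucc) = G.source (edge i.succ)

namespace Path

variable {G : DirectedGraph V E}

/-- The first edge of a path. -/
def first (α : G.Path) : E := α.edge 0

/-- The last edge of a path. -/
def last (α : G.Path) : E := α.edge (Fin.last α.length)

/-- The source of a path. -/
def source (α : G.Path) : V := G.source α.first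

/-- The range of a path. -/
def range (α : G.Path) : V := G.range α.last

end Path

/-- The graph obtained from `G` by adding, for every `m : ℕ`, a new edge `αᵐ` with the source and
the range of the path `α`. -/
def addPathEdges (G : DirectedGraph V E) (α : G.Path) : DirectedGraph V (E ⊕ ℕ) where
  source := Sum.elim G.source fun _ => α.source
  range := Sum.elim G.range fun _ => α.range

/-- A Cuntz-Krieger `G`-family in a C⋆-algebra `B`. For projections, `q ≤ p` means `p * q = q`. -/
structure CuntzKriegerFamily (G : DirectedGraph V E) (B : Type w) [NonUnitalCStarAlgebra B] where
  /-- the projections `p_v` -/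
  p : V → B
  /-- the partial isometries `s_e` -/
  s : E → B
  isStarProjection : ∀ v, IsStarProjection (p v)
  orthogonal : ∀ v w, v ≠ w → p v * p w = 0
  isPartialIsometry : ∀ e, s e * star (s e) * s e = s e
  ck0 : ∀ e f, e ≠ f → star (s e) * s f = 0
  ck1 : ∀ e, star (s e) * s e = p (G.range e)
  ck2 : ∀ e, p (G.source e) * (s e * star (s e)) = s e * star (s e)
  ck3 : ∀ v, ∀ h : {e | G.source e = v}.Finite, {e | G.source e = v}.Nonempty →
    p v = ∑ e ∈ h.toFinset, s e * star (s e)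

end DirectedGraph

/-! ### The free (non-unital) ⋆-algebra on a set -/

/-- Words in the letters `x` and `x⋆`, for `x : X`: the letter `(x, false)` is `x` and the letter
`(x, true)` is `x⋆`. -/
abbrev StarWord (X : Type u) : Type u := FreeSemigroup (X × Bool)

namespace StarWord

variable {X : Type u}

/-- The adjoint of a word: reverse it, and exchange `x` and `x⋆`. -/
def adjoint (a : StarWord X) : StarWord X :=
  (FreeSemigroup.lift (fun x : X × Bool => MulOpposite.op (FreeSemigroup.of (x.1, !x.2))) a).unop

theorem adjoint_of (x : X × Bool) :
    adjoint (FreeSemigroup.of x) = FreeSemigroup.of (x.1, !x.2) := rfl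

theorem adjoint_mul (a b : StarWord X) : adjoint (a * b) = adjoint b * adjoint a := by
  simp [adjoint]

theorem adjoint_adjoint (a : StarWord X) : adjoint (adjoint a) = a := by
  induction a using FreeSemigroup.recOnMul with
  | ih1 x => simp [adjoint_of]
  | ih2 x a hx ha => rw [adjoint_mul, adjoint_mul, hx, ha]

end StarWord

/-- The free non-unital complex ⋆-algebra on the set `X`. -/
abbrev FreeStarAlgebra (X : Type u) : Type u := MonoidAlgebra ℂ (StarWord X)

namespace FreeStarAlgebra

open MonoidAlgebra

variable {X : Type u}

/-- The conjugate-linear extension of the adjoint of words. -/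
noncomputable def starHom : FreeStarAlgebra X →+ FreeStarAlgebra X :=
  (Finsupp.liftAddHom fun a : StarWord X =>
    (singleAddHom (StarWord.adjoint a)).comp (starAddEquiv (R := ℂ)).toAddMonoidHom).comp
      coeffAddEquiv.toAddMonoidHom

theorem starHom_single (a : StarWord X) (c : ℂ) :
    starHom (single a c) = single a.adjoint (star c) := by
  simp [starHom]

noncomputable instance : StarRing (FreeStarAlgebra X) where
  star := starHom
  star_involutive x := by
    induction x using MonoidAlgebra.induction_linear with
    | zero => simp
    | add f g hf hg => rw [map_add, map_add, hf, hg]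
    | single a c => simp [starHom_single, StarWord.adjoint_adjoint]
  star_mul x y := by
    change starHom (x * y) = starHom y * starHom x
    induction x using MonoidAlgebra.induction_linear with
    | zero => simp
    | add f g hf hg => rw [add_mul, map_add, map_add, mul_add, hf, hg]
    | single a c =>
      induction y using MonoidAlgebra.induction_linear with
      | zero => simp
      | add f g hf hg => rw [mul_add, map_add, map_add, add_mul, hf, hg]
      | single b d =>
        simp [starHom_single, single_mul_single, StarWord.adjoint_mul, mul_comm]
  star_add x y := map_add starHom x y

theorem star_single (a : StarWord X) (c : ℂ) :
    star (single a c : FreeStarAlgebra X) = single a.adjoint (star c) :=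
  starHom_single a c

instance : StarModule ℂ (FreeStarAlgebra X) where
  star_smul c x := by
    induction x using MonoidAlgebra.induction_linear with
    | zero => simp
    | add f g hf hg => rw [smul_add, star_add, star_add, smul_add, hf, hg]
    | single a d => simp [star_single]

/-- The generators. -/
noncomputable def of (x : X) : FreeStarAlgebra X := single (FreeSemigroup.of (x, false)) 1

variable {B : Type v} [NonUnitalRing B] [StarRing B]

/-- The value of a letter. -/
def letter (f : X → B) (x : X × Bool) : B := if x.2 then star (f x.1) else f x.1

theorem lift_adjoint (f : X → B) (a : StarWord X) :
    FreeSemigroup.lift (letter f) a.adjoint = star (FreeSemigroup.lift (letter f) a) := by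
  induction a using FreeSemigroup.recOnMul with
  | ih1 x => rcases x with ⟨x, _ | _⟩ <;> simp [StarWord.adjoint_of, letter]
  | ih2 x a hx ha => rw [StarWord.adjoint_mul, map_mul, map_mul, star_mul, hx, ha]

variable [Module ℂ B] [IsScalarTower ℂ B B] [SMulCommClass ℂ B B] [StarModule ℂ B]

/-- The ⋆-homomorphism that evaluates noncommutative ⋆-polynomials. -/
noncomputable def lift (f : X → B) : FreeStarAlgebra X →⋆ₙₐ[ℂ] B where
  __ := liftMagma ℂ (FreeSemigroup.lift (letter f))
  map_star' x := by
    change liftMagma ℂ (FreeSemigroup.lift (letter f)) (star x) =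
      star (liftMagma ℂ (FreeSemigroup.lift (letter f)) x)
    induction x using MonoidAlgebra.induction_linear with
    | zero => simp
    | add g h hg hh => rw [star_add, map_add, map_add, star_add, hg, hh]
    | single a c => simp [star_single, lift_adjoint]

theorem lift_single (f : X → B) (a : StarWord X) (c : ℂ) :
    lift f (single a c) = c • FreeSemigroup.lift (letter f) a := by
  change liftMagma ℂ (FreeSemigroup.lift (letter f)) (single a c) = _
  simp

theorem lift_of (f : X → B) (x : X) : lift f (of x) = f x := by
  simp [of, lift_single, letter]

end FreeStarAlgebra

/-! ### The completion of a ⋆-algebra with a C⋆-seminorm -/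

namespace StarCompletion

open UniformSpace Completion

variable {A : Type u} [NonUnitalSeminormedRing A]

/-- The multiplication, extended by continuity. -/
noncomputable def mul (a b : Completion A) : Completion A :=
  ((isDenseInducing_coe (α := A)).prodMap (isDenseInducing_coe (α := A))).extend
    (fun p : A × A => ((p.1 * p.2 : A) : Completion A)) (a, b)

theorem coe_mul (x y : A) : ((x * y : A) : Completion A) = mul (x : Completion A) y :=
  ((isDenseInducing_coe.prodMap isDenseInducing_coe).extend_eq
    ((continuous_coe A).comp continuous_mul) (x, y)).symm

theorem continuous_mul' : Continuous fun p : Completion A × Completion A => mul p.1 p.2 := by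
  let m := (AddMonoidHom.mul : A →+ A →+ A).compr₂ (toCompl : A →+ Completion A)
  have h : Continuous fun p : A × A => m p.1 p.2 := (continuous_coe A).comp continuous_mul
  have di : IsDenseInducing (toCompl : A → Completion A) := isDenseInducing_coe
  exact (di.extend_Z_bilin di h :)

theorem _root_.Continuous.starCompletion_mul {X : Type*} [TopologicalSpace X]
    {f g : X → Completion A} (hf : Continuous f) (hg : Continuous g) :
    Continuous fun x => mul (f x) (g x) :=
  continuous_mul'.comp (hf.prodMk hg)

theorem mul_add' (a b c : Completion A) : mul a (b + c) = mul a b + mul a c := by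
  induction a using Completion.induction_on with
  | hp =>
    exact isClosed_eq
      (continuous_id.starCompletion_mul continuous_const)
      ((continuous_id.starCompletion_mul continuous_const).add (continuous_id.starCompletion_mul continuous_const))
  | ih x =>
  induction b using Completion.induction_on with
  | hp =>
    exact isClosed_eq
      (continuous_const.starCompletion_mul (continuous_id.add continuous_const))
      ((continuous_const.starCompletion_mul continuous_id).add continuous_const)
  | ih y =>
  induction c using Completion.induction_on with
  | hp =>
    exact isClosed_eq
      (continuous_const.starCompletion_mul (continuous_const.add continuous_id))
      (continuous_const.add (continuous_const.starCompletion_mul continuous_id))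
  | ih z =>
  rw [← coe_add, ← coe_mul, ← coe_mul, ← coe_mul, ← coe_add, mul_add]

theorem add_mul' (a b c : Completion A) : mul (a + b) c = mul a c + mul b c := by
  induction a using Completion.induction_on with
  | hp =>
    exact isClosed_eq
      ((continuous_id.add continuous_const).starCompletion_mul continuous_const)
      ((continuous_id.starCompletion_mul continuous_const).add continuous_const)
  | ih x =>
  induction b using Completion.induction_on with
  | hp =>
    exact isClosed_eq
      ((continuous_const.add continuous_id).starCompletion_mul continuous_const)
      (continuous_const.add (continuous_id.starCompletion_mul continuous_const))
  | ih y =>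
  induction c using Completion.induction_on with
  | hp =>
    exact isClosed_eq
      (continuous_const.starCompletion_mul continuous_id)
      ((continuous_const.starCompletion_mul continuous_id).add (continuous_const.starCompletion_mul continuous_id))
  | ih z =>
  rw [← coe_add, ← coe_mul, ← coe_mul, ← coe_mul, ← coe_add, add_mul]

theorem mul_assoc' (a b c : Completion A) : mul (mul a b) c = mul a (mul b c) := by
  induction a using Completion.induction_on with
  | hp =>
    exact isClosed_eq
      ((continuous_id.starCompletion_mul continuous_const).starCompletion_mul continuous_const)
      (continuous_id.starCompletion_mul continuous_const)
  | ih x =>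
  induction b using Completion.induction_on with
  | hp =>
    exact isClosed_eq
      ((continuous_const.starCompletion_mul continuous_id).starCompletion_mul continuous_const)
      (continuous_const.starCompletion_mul (continuous_id.starCompletion_mul continuous_const))
  | ih y =>
  induction c using Completion.induction_on with
  | hp =>
    exact isClosed_eq
      (continuous_const.starCompletion_mul continuous_id)
      (continuous_const.starCompletion_mul (continuous_const.starCompletion_mul continuous_id))
  | ih z =>
  rw [← coe_mul, ← coe_mul, ← coe_mul, ← coe_mul, mul_assoc]

theorem zero_mul' (a : Completion A) : mul 0 a = 0 := by
  induction a using Completion.induction_on with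
  | hp =>
    exact isClosed_eq
      (continuous_const.starCompletion_mul continuous_id)
      (continuous_const)
  | ih x =>
  rw [← coe_zero, ← coe_mul, zero_mul]

theorem mul_zero' (a : Completion A) : mul a 0 = 0 := by
  induction a using Completion.induction_on with
  | hp =>
    exact isClosed_eq
      (continuous_id.starCompletion_mul continuous_const)
      (continuous_const)
  | ih x =>
  rw [← coe_zero, ← coe_mul, mul_zero]

theorem norm_mul_le' (a b : Completion A) : ‖mul a b‖ ≤ ‖a‖ * ‖b‖ := by
  induction a using Completion.induction_on with
  | hp =>
    exact isClosed_le
      (continuous_norm.comp (continuous_id.starCompletion_mul continuous_const))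
      (continuous_norm.mul continuous_const)
  | ih x =>
  induction b using Completion.induction_on with
  | hp =>
    exact isClosed_le
      (continuous_norm.comp (continuous_const.starCompletion_mul continuous_id))
      (continuous_const.mul continuous_norm)
  | ih y =>
  simpa only [← coe_mul, norm_coe] using norm_mul_le x y

theorem smul_mul' [NormedSpace ℂ A] [IsScalarTower ℂ A A] (c : ℂ) (a b : Completion A) : mul (c • a) b = c • mul a b := by
  induction a using Completion.induction_on with
  | hp =>
    exact isClosed_eq
      ((continuous_id.const_smul c).starCompletion_mul continuous_const)
      ((continuous_id.starCompletion_mul continuous_const).const_smul c)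
  | ih x =>
  induction b using Completion.induction_on with
  | hp =>
    exact isClosed_eq
      (continuous_const.starCompletion_mul continuous_id)
      ((continuous_const.starCompletion_mul continuous_id).const_smul c)
  | ih y =>
  rw [← coe_smul, ← coe_mul, ← coe_mul, ← coe_smul, smul_mul_assoc]

theorem mul_smul' [NormedSpace ℂ A] [SMulCommClass ℂ A A] (c : ℂ) (a b : Completion A) : mul a (c • b) = c • mul a b := by
  induction a using Completion.induction_on with
  | hp =>
    exact isClosed_eq
      (continuous_id.starCompletion_mul continuous_const)
      ((continuous_id.starCompletion_mul continuous_const).const_smul c)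
  | ih x =>
  induction b using Completion.induction_on with
  | hp =>
    exact isClosed_eq
      (continuous_const.starCompletion_mul (continuous_id.const_smul c))
      ((continuous_const.starCompletion_mul continuous_id).const_smul c)
  | ih y =>
  rw [← coe_smul, ← coe_mul, ← coe_mul, ← coe_smul, mul_smul_comm]

variable [StarRing A]

/-- The adjoint, extended by continuity. -/
noncomputable def adj (a : Completion A) : Completion A := Completion.map (star : A → A) a

theorem continuous_adj : Continuous (adj : Completion A → Completion A) := continuous_map

variable [NormedStarGroup A]

theorem coe_star (x : A) : ((star x : A) : Completion A) = adj (x : Completion A) :=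
  (map_coe star_isometry.uniformContinuous x).symm

theorem adj_adj (a : Completion A) : adj (adj a) = a := by
  induction a using Completion.induction_on with
  | hp =>
    exact isClosed_eq
      (continuous_adj.comp (continuous_adj))
      (continuous_id)
  | ih x =>
  rw [← coe_star, ← coe_star, star_star]

theorem adj_mul (a b : Completion A) : adj (mul a b) = mul (adj b) (adj a) := by
  induction a using Completion.induction_on with
  | hp =>
    exact isClosed_eq
      (continuous_adj.comp (continuous_id.starCompletion_mul continuous_const))
      (continuous_const.starCompletion_mul (continuous_adj))
  | ih x =>
  induction b using Completion.induction_on with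
  | hp =>
    exact isClosed_eq
      (continuous_adj.comp (continuous_const.starCompletion_mul continuous_id))
      ((continuous_adj).starCompletion_mul continuous_const)
  | ih y =>
  rw [← coe_mul, ← coe_star, ← coe_star, ← coe_star, ← coe_mul, star_mul]

theorem adj_add (a b : Completion A) : adj (a + b) = adj a + adj b := by
  induction a using Completion.induction_on with
  | hp =>
    exact isClosed_eq
      (continuous_adj.comp (continuous_id.add continuous_const))
      ((continuous_adj).add continuous_const)
  | ih x =>
  induction b using Completion.induction_on with
  | hp =>
    exact isClosed_eq
      (continuous_adj.comp (continuous_const.add continuous_id))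
      (continuous_const.add (continuous_adj))
  | ih y =>
  rw [← coe_add, ← coe_star, ← coe_star, ← coe_star, ← coe_add, star_add]

theorem norm_mul_self_le' (h : ∀ x : A, ‖x‖ * ‖x‖ ≤ ‖star x * x‖) (a : Completion A) : ‖a‖ * ‖a‖ ≤ ‖mul (adj a) a‖ := by
  induction a using Completion.induction_on with
  | hp =>
    exact isClosed_le
      (continuous_norm.mul continuous_norm)
      (continuous_norm.comp ((continuous_adj).starCompletion_mul continuous_id))
  | ih x =>
  simpa only [← coe_star, ← coe_mul, norm_coe] using h x

variable [NormedSpace ℂ A]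

theorem adj_smul [StarModule ℂ A] (c : ℂ) (a : Completion A) : adj (c • a) = star c • adj a := by
  induction a using Completion.induction_on with
  | hp =>
    exact isClosed_eq
      (continuous_adj.comp (continuous_id.const_smul c))
      (continuous_adj.const_smul (star c))
  | ih x =>
  rw [← coe_smul, ← coe_star, ← coe_star, ← coe_smul, star_smul]

/-- The Hausdorff completion of a ⋆-algebra with respect to a C⋆-seminorm is a C⋆-algebra, with the
operations extended by continuity. -/
noncomputable abbrev nonUnitalCStarAlgebra [IsScalarTower ℂ A A] [SMulCommClass ℂ A A]
    [StarModule ℂ A] (h : ∀ x : A, ‖x‖ * ‖x‖ ≤ ‖star x * x‖) :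
    NonUnitalCStarAlgebra (Completion A) where
  __ := (inferInstance : NormedAddCommGroup (Completion A))
  __ := (inferInstance : NormedSpace ℂ (Completion A))
  mul := mul
  left_distrib := mul_add'
  right_distrib := add_mul'
  zero_mul := zero_mul'
  mul_zero := mul_zero'
  mul_assoc := mul_assoc'
  norm_mul_le := norm_mul_le'
  star := adj
  star_involutive := adj_adj
  star_mul := adj_mul
  star_add := adj_add
  complete := CompleteSpace.complete
  norm_mul_self_le := norm_mul_self_le' h
  smul_assoc := smul_mul'
  smul_comm c a b := (mul_smul' c a b).symm
  star_smul := adj_smul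

end StarCompletion

/-! ### The universal C⋆-algebra of a graph -/

namespace DirectedGraph

variable {V : Type u} {E : Type v}

/-- The value of a noncommutative ⋆-polynomial in the generators `p_v`, `s_e` at a Cuntz-Krieger
family. -/
noncomputable def CuntzKriegerFamily.eval {G : DirectedGraph V E} {B : Type w}
    [NonUnitalCStarAlgebra B] (S : G.CuntzKriegerFamily B) : FreeStarAlgebra (V ⊕ E) →⋆ₙₐ[ℂ] B :=
  FreeStarAlgebra.lift (Sum.elim S.p S.s)

namespace CuntzKriegerFamily

variable {G : DirectedGraph V E} {B : Type w} [NonUnitalCStarAlgebra B]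
  (S : G.CuntzKriegerFamily B)

theorem norm_le_one_of_isStarProjection {q : B} (hq : IsStarProjection q) : ‖q‖ ≤ 1 := by
  have h : ‖q‖ * ‖q‖ = ‖q‖ := by
    rw [← CStarRing.norm_star_mul_self (x := q), hq.isSelfAdjoint.star_eq, hq.isIdempotentElem.eq]
  nlinarith [norm_nonneg q]

theorem norm_letter_le (x : (V ⊕ E) × Bool) :
    ‖FreeStarAlgebra.letter (Sum.elim S.p S.s) x‖ ≤ 1 := by
  have key : ∀ y : V ⊕ E, ‖Sum.elim S.p S.s y‖ ≤ 1 := by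
    rintro (v | e)
    · exact norm_le_one_of_isStarProjection (S.isStarProjection v)
    · have h := CStarRing.norm_star_mul_self (x := S.s e)
      rw [S.ck1] at h
      have := norm_le_one_of_isStarProjection (S.isStarProjection (G.range e))
      have h0 := norm_nonneg (S.s e)
      change ‖S.s e‖ ≤ 1
      nlinarith
  rcases x with ⟨y, _ | _⟩
  · simpa [FreeStarAlgebra.letter] using key y
  · simpa [FreeStarAlgebra.letter] using key y

theorem norm_word_le (a : StarWord (V ⊕ E)) :
    ‖FreeSemigroup.lift (FreeStarAlgebra.letter (Sum.elim S.p S.s)) a‖ ≤ 1 := by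
  induction a using FreeSemigroup.recOnMul with
  | ih1 x => simpa using S.norm_letter_le x
  | ih2 x a hx ha =>
    rw [map_mul]
    exact (norm_mul_le _ _).trans (mul_le_one₀ hx (norm_nonneg _) ha)

end CuntzKriegerFamily

/-- The values `‖x(p, s)‖`, for all Cuntz-Krieger `G`-families `(p, s)`. The C⋆-algebra generated
by such a family is always isomorphic to one whose underlying type lies in `Type (max u v)`. -/
def normSet (G : DirectedGraph V E) (x : FreeStarAlgebra (V ⊕ E)) : Set ℝ :=
  {r | ∃ (B : Type (max u v)) (_ : NonUnitalCStarAlgebra B) (S : G.CuntzKriegerFamily B),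
    r = ‖S.eval x‖}

/-- The largest C⋆-seminorm coming from a Cuntz-Krieger `G`-family. -/
noncomputable def universalNorm (G : DirectedGraph V E) (x : FreeStarAlgebra (V ⊕ E)) : ℝ :=
  sSup (G.normSet x)

theorem bddAbove_normSet (G : DirectedGraph V E) (x : FreeStarAlgebra (V ⊕ E)) :
    BddAbove (G.normSet x) := by
  suffices h : ∃ c : ℝ, ∀ (B : Type (max u v)) (_ : NonUnitalCStarAlgebra B)
      (S : G.CuntzKriegerFamily B), ‖S.eval x‖ ≤ c by
    obtain ⟨c, hc⟩ := h
    exact ⟨c, by rintro r ⟨B, i, S, rfl⟩; exact hc B i S⟩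
  induction x using MonoidAlgebra.induction_linear with
  | zero => exact ⟨0, fun B i S => by simp⟩
  | add f g hf hg =>
    obtain ⟨c, hc⟩ := hf
    obtain ⟨d, hd⟩ := hg
    refine ⟨c + d, fun B i S => ?_⟩
    rw [map_add]
    exact (norm_add_le _ _).trans (add_le_add (hc B i S) (hd B i S))
  | single a c =>
    refine ⟨‖c‖, fun B i S => ?_⟩
    rw [CuntzKriegerFamily.eval, FreeStarAlgebra.lift_single, norm_smul]
    exact mul_le_of_le_one_right (norm_nonneg _) (S.norm_word_le a)

theorem norm_eval_le (G : DirectedGraph V E) {B : Type (max u v)} [i : NonUnitalCStarAlgebra B]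
    (S : G.CuntzKriegerFamily B) (x : FreeStarAlgebra (V ⊕ E)) :
    ‖S.eval x‖ ≤ G.universalNorm x :=
  le_csSup (G.bddAbove_normSet x) ⟨B, i, S, rfl⟩

theorem universalNorm_nonneg (G : DirectedGraph V E) (x : FreeStarAlgebra (V ⊕ E)) :
    0 ≤ G.universalNorm x :=
  Real.sSup_nonneg (by rintro r ⟨B, i, S, rfl⟩; exact norm_nonneg _)

theorem universalNorm_le (G : DirectedGraph V E) {x : FreeStarAlgebra (V ⊕ E)} {c : ℝ} (hc : 0 ≤ c)
    (h : ∀ (B : Type (max u v)) (_ : NonUnitalCStarAlgebra B) (S : G.CuntzKriegerFamily B),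
      ‖S.eval x‖ ≤ c) : G.universalNorm x ≤ c :=
  Real.sSup_le (by rintro r ⟨B, i, S, rfl⟩; exact h B i S) hc

theorem universalNorm_star_le (G : DirectedGraph V E) (x : FreeStarAlgebra (V ⊕ E)) :
    G.universalNorm (star x) ≤ G.universalNorm x :=
  G.universalNorm_le (G.universalNorm_nonneg x) fun B i S => by
    rw [map_star, norm_star]
    exact G.norm_eval_le S x

theorem universalNorm_mul_le (G : DirectedGraph V E) (x y : FreeStarAlgebra (V ⊕ E)) :
    G.universalNorm (x * y) ≤ G.universalNorm x * G.universalNorm y :=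
  G.universalNorm_le (mul_nonneg (G.universalNorm_nonneg x) (G.universalNorm_nonneg y))
    fun B i S => by
      rw [map_mul]
      exact (norm_mul_le _ _).trans (mul_le_mul (G.norm_eval_le S x) (G.norm_eval_le S y)
        (norm_nonneg _) (G.universalNorm_nonneg x))

theorem universalNorm_smul_le (G : DirectedGraph V E) (c : ℂ) (x : FreeStarAlgebra (V ⊕ E)) :
    G.universalNorm (c • x) ≤ ‖c‖ * G.universalNorm x :=
  G.universalNorm_le (mul_nonneg (norm_nonneg c) (G.universalNorm_nonneg x)) fun B i S => by
    rw [map_smul, norm_smul]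
    exact mul_le_mul_of_nonneg_left (G.norm_eval_le S x) (norm_nonneg c)

/-- The universal norm, as a seminorm on an additive group. -/
noncomputable def universalSeminorm (G : DirectedGraph V E) :
    AddGroupSeminorm (FreeStarAlgebra (V ⊕ E)) where
  toFun := G.universalNorm
  map_zero' := le_antisymm
    (G.universalNorm_le le_rfl fun B i S => by simp) (G.universalNorm_nonneg _)
  add_le' x y := G.universalNorm_le
    (add_nonneg (G.universalNorm_nonneg x) (G.universalNorm_nonneg y)) fun B i S => by
      rw [map_add]
      exact (norm_add_le _ _).trans (add_le_add (G.norm_eval_le S x) (G.norm_eval_le S y))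
  neg' x := le_antisymm
    (G.universalNorm_le (G.universalNorm_nonneg x) fun B i S => by
      rw [map_neg, norm_neg]; exact G.norm_eval_le S x)
    (G.universalNorm_le (G.universalNorm_nonneg (-x)) fun B i S => by
      rw [← norm_neg, ← map_neg]; exact G.norm_eval_le S (-x))

/-- The free ⋆-algebra on the symbols `p_v`, `s_e`, with the seminorm `universalNorm`. -/
def PreAlgebra (_G : DirectedGraph V E) : Type (max u v) := FreeStarAlgebra (V ⊕ E)

namespace PreAlgebra

variable (G : DirectedGraph V E)

noncomputable instance : NonUnitalSeminormedRing G.PreAlgebra where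
  __ := G.universalSeminorm.toSeminormedAddCommGroup
  __ := (inferInstance : NonUnitalRing (FreeStarAlgebra (V ⊕ E)))
  norm_mul_le := G.universalNorm_mul_le

noncomputable instance : StarRing G.PreAlgebra :=
  inferInstanceAs (StarRing (FreeStarAlgebra (V ⊕ E)))

noncomputable instance : NormedSpace ℂ G.PreAlgebra where
  __ := (inferInstance : Module ℂ (FreeStarAlgebra (V ⊕ E)))
  norm_smul_le := G.universalNorm_smul_le

instance : IsScalarTower ℂ G.PreAlgebra G.PreAlgebra :=
  inferInstanceAs (IsScalarTower ℂ (FreeStarAlgebra (V ⊕ E)) (FreeStarAlgebra (V ⊕ E)))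
instance : SMulCommClass ℂ G.PreAlgebra G.PreAlgebra :=
  inferInstanceAs (SMulCommClass ℂ (FreeStarAlgebra (V ⊕ E)) (FreeStarAlgebra (V ⊕ E)))
instance : StarModule ℂ G.PreAlgebra :=
  inferInstanceAs (StarModule ℂ (FreeStarAlgebra (V ⊕ E)))

instance : NormedStarGroup G.PreAlgebra where
  norm_star_le := G.universalNorm_star_le

variable {G}

/-- The symbol `p_v` or `s_e`. -/
noncomputable def of (x : V ⊕ E) : G.PreAlgebra := FreeStarAlgebra.of x

/-- `CuntzKriegerFamily.eval`, on `PreAlgebra`. -/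
noncomputable def eval {B : Type w} [NonUnitalCStarAlgebra B]
    (S : G.CuntzKriegerFamily B) : G.PreAlgebra →⋆ₙₐ[ℂ] B := S.eval

theorem norm_eval_le {B : Type (max u v)} [NonUnitalCStarAlgebra B]
    (S : G.CuntzKriegerFamily B) (x : G.PreAlgebra) : ‖eval S x‖ ≤ ‖x‖ :=
  G.norm_eval_le S x

theorem norm_le_of_forall {x : G.PreAlgebra} {c : ℝ} (hc : 0 ≤ c)
    (h : ∀ (B : Type (max u v)) (_ : NonUnitalCStarAlgebra B) (S : G.CuntzKriegerFamily B),
      ‖eval S x‖ ≤ c) : ‖x‖ ≤ c :=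
  G.universalNorm_le hc h

theorem norm_mul_self_le (x : G.PreAlgebra) : ‖x‖ * ‖x‖ ≤ ‖star x * x‖ := by
  have h : ‖x‖ ≤ √‖star x * x‖ := norm_le_of_forall (Real.sqrt_nonneg _) fun B i S => by
    apply Real.le_sqrt_of_sq_le
    rw [sq, ← CStarRing.norm_star_mul_self, ← map_star, ← map_mul]
    exact norm_eval_le S _
  calc ‖x‖ * ‖x‖ ≤ √‖star x * x‖ * √‖star x * x‖ :=
        mul_self_le_mul_self (norm_nonneg x) h
    _ = ‖star x * x‖ := Real.mul_self_sqrt (norm_nonneg _)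

end PreAlgebra

/-- The graph C⋆-algebra `C⋆(G)`: the universal C⋆-algebra generated by a Cuntz-Krieger `G`-family,
constructed as the Hausdorff completion of the free ⋆-algebra on the symbols `p_v`, `s_e` with
respect to the largest C⋆-seminorm that comes from a Cuntz-Krieger `G`-family. -/
def GraphCStarAlgebra (G : DirectedGraph V E) : Type (max u v) :=
  UniformSpace.Completion G.PreAlgebra

namespace GraphCStarAlgebra

open UniformSpace

noncomputable instance (G : DirectedGraph V E) : NonUnitalCStarAlgebra G.GraphCStarAlgebra :=
  StarCompletion.nonUnitalCStarAlgebra (PreAlgebra.norm_mul_self_le (G := G))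


variable {G : DirectedGraph V E}

/-- The canonical map from the free ⋆-algebra to `C⋆(G)`. -/
noncomputable def mk (x : G.PreAlgebra) : G.GraphCStarAlgebra := (x : Completion G.PreAlgebra)

theorem norm_mk (x : G.PreAlgebra) : ‖mk x‖ = ‖x‖ := Completion.norm_coe x
theorem mk_add (x y : G.PreAlgebra) : mk (x + y) = mk x + mk y := Completion.coe_add x y
theorem mk_zero : mk (0 : G.PreAlgebra) = 0 := rfl
theorem mk_smul (c : ℂ) (x : G.PreAlgebra) : mk (c • x) = c • mk x := Completion.coe_smul c x
theorem mk_mul (x y : G.PreAlgebra) : mk (x * y) = mk x * mk y := StarCompletion.coe_mul x y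
theorem mk_star (x : G.PreAlgebra) : mk (star x) = star (mk x) := StarCompletion.coe_star x

/-- The canonical map, as a homomorphism of additive groups. -/
noncomputable def mkHom : G.PreAlgebra →+ G.GraphCStarAlgebra where
  toFun := mk
  map_zero' := mk_zero
  map_add' := mk_add

@[elab_as_elim]
theorem ind {motive : G.GraphCStarAlgebra → Prop} (a : G.GraphCStarAlgebra)
    (hp : IsClosed {a | motive a}) (ih : ∀ x, motive (mk x)) : motive a :=
  Completion.induction_on a hp ih

/-- The generator of `C⋆(G)` that belongs to a vertex or to an edge. -/
noncomputable def gen (x : V ⊕ E) : G.GraphCStarAlgebra := mk (PreAlgebra.of x)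

theorem mk_sub (x y : G.PreAlgebra) : mk (x - y) = mk x - mk y := Completion.coe_sub x y

theorem mk_eq_mk {x y : G.PreAlgebra}
    (h : ∀ (B : Type (max u v)) (_ : NonUnitalCStarAlgebra B) (S : G.CuntzKriegerFamily B),
      PreAlgebra.eval S x = PreAlgebra.eval S y) : mk x = mk y := by
  rw [← sub_eq_zero, ← norm_le_zero_iff, ← mk_sub, norm_mk]
  exact PreAlgebra.norm_le_of_forall le_rfl fun B i S => by rw [map_sub, h B i S]; simp

theorem eval_of {B : Type w} [NonUnitalCStarAlgebra B] (S : G.CuntzKriegerFamily B) (x : V ⊕ E) :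
    PreAlgebra.eval S (PreAlgebra.of x) = Sum.elim S.p S.s x :=
  FreeStarAlgebra.lift_of _ x

theorem mk_sum {ι : Type*} (t : Finset ι) (f : ι → G.PreAlgebra) :
    mk (∑ i ∈ t, f i) = ∑ i ∈ t, mk (f i) := map_sum mkHom f t

variable (G) in
/-- The canonical Cuntz-Krieger `G`-family in `C⋆(G)`. -/
noncomputable def family : G.CuntzKriegerFamily G.GraphCStarAlgebra where
  p v := gen (Sum.inl v)
  s e := gen (Sum.inr e)
  isStarProjection v :=
    { isIdempotentElem := by
        unfold IsIdempotentElem gen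
        rw [← mk_mul]
        exact mk_eq_mk fun B i S => by
          simpa [eval_of] using (S.isStarProjection v).isIdempotentElem.eq
      isSelfAdjoint := by
        unfold IsSelfAdjoint gen
        rw [← mk_star]
        exact mk_eq_mk fun B i S => by
          simpa [map_star, eval_of] using (S.isStarProjection v).isSelfAdjoint.star_eq }
  orthogonal v w h := by
    unfold gen
    rw [← mk_mul, ← mk_zero]
    exact mk_eq_mk fun B i S => by simpa [eval_of] using S.orthogonal v w h
  isPartialIsometry e := by
    unfold gen
    rw [← mk_star, ← mk_mul, ← mk_mul]
    exact mk_eq_mk fun B i S => by simpa [map_star, eval_of] using S.isPartialIsometry e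
  ck0 e f h := by
    unfold gen
    rw [← mk_star, ← mk_mul, ← mk_zero]
    exact mk_eq_mk fun B i S => by simpa [map_star, eval_of] using S.ck0 e f h
  ck1 e := by
    unfold gen
    rw [← mk_star, ← mk_mul]
    exact mk_eq_mk fun B i S => by simpa [map_star, eval_of] using S.ck1 e
  ck2 e := by
    unfold gen
    rw [← mk_star, ← mk_mul, ← mk_mul]
    exact mk_eq_mk fun B i S => by simpa [map_star, eval_of] using S.ck2 e
  ck3 v h hn := by
    unfold gen
    simp only [← mk_star, ← mk_mul, ← mk_sum]
    exact mk_eq_mk fun B i S => by simpa [map_star, map_sum, eval_of] using S.ck3 v h hn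

/-- The universal property, existence. -/
theorem exists_lift {B : Type (max u v)} [NonUnitalCStarAlgebra B] (S : G.CuntzKriegerFamily B) :
    ∃ φ : G.GraphCStarAlgebra →⋆ₙₐ[ℂ] B,
      (∀ v, φ ((family G).p v) = S.p v) ∧ ∀ e, φ ((family G).s e) = S.s e := by
  have huc : UniformContinuous (PreAlgebra.eval S) :=
    AddMonoidHomClass.uniformContinuous_of_bound (PreAlgebra.eval S) 1
      (fun x => by simpa using PreAlgebra.norm_eval_le S x)
  let ψ : G.GraphCStarAlgebra → B := Completion.extension (PreAlgebra.eval S)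
  have hc : Continuous ψ := Completion.continuous_extension
  have hψ : ∀ x, ψ (mk x) = PreAlgebra.eval S x := fun x => Completion.extension_coe huc x
  have h0 : ψ 0 = 0 := by rw [← mk_zero, hψ, map_zero]
  have hadd : ∀ a b, ψ (a + b) = ψ a + ψ b := fun a b => by
    induction a using ind with
    | hp => exact isClosed_eq (hc.comp (continuous_id.add continuous_const))
              (hc.add continuous_const)
    | ih x =>
    induction b using ind with
    | hp => exact isClosed_eq (hc.comp (continuous_const.add continuous_id))
              (continuous_const.add hc)
    | ih y => rw [← mk_add, hψ, hψ, hψ, map_add]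
  have hmul : ∀ a b, ψ (a * b) = ψ a * ψ b := fun a b => by
    induction a using ind with
    | hp => exact isClosed_eq (hc.comp (continuous_id.mul continuous_const))
              (hc.mul continuous_const)
    | ih x =>
    induction b using ind with
    | hp => exact isClosed_eq (hc.comp (continuous_const.mul continuous_id))
              (continuous_const.mul hc)
    | ih y => rw [← mk_mul, hψ, hψ, hψ, map_mul]
  have hsmul : ∀ (c : ℂ) a, ψ (c • a) = c • ψ a := fun c a => by
    induction a using ind with
    | hp => exact isClosed_eq (hc.comp (continuous_id.const_smul c)) (hc.const_smul c)
    | ih x => rw [← mk_smul, hψ, hψ, map_smul]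
  have hstar : ∀ a, ψ (star a) = star (ψ a) := fun a => by
    induction a using ind with
    | hp => exact isClosed_eq (hc.comp continuous_star) hc.star
    | ih x => rw [← mk_star, hψ, hψ, map_star]
  exact ⟨{ toFun := ψ, map_smul' := hsmul, map_zero' := h0, map_add' := hadd, map_mul' := hmul,
           map_star' := hstar },
    fun v => (hψ _).trans (eval_of S _), fun e => (hψ _).trans (eval_of S _)⟩

/-- The universal property, uniqueness: `C⋆(G)` is generated by the canonical family. -/
theorem hom_ext {B : Type w} [NonUnitalCStarAlgebra B] {φ ψ : G.GraphCStarAlgebra →⋆ₙₐ[ℂ] B}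
    (hp : ∀ v, φ ((family G).p v) = ψ ((family G).p v))
    (hs : ∀ e, φ ((family G).s e) = ψ ((family G).s e)) : φ = ψ := by
  have hgen : ∀ x : V ⊕ E, φ (gen x) = ψ (gen x) := by
    rintro (v | e)
    exacts [hp v, hs e]
  have hword : ∀ a : StarWord (V ⊕ E), φ (mk (MonoidAlgebra.single a 1 : FreeStarAlgebra (V ⊕ E))) =
      ψ (mk (MonoidAlgebra.single a 1 : FreeStarAlgebra (V ⊕ E))) := by
    have hl : ∀ x : (V ⊕ E) × Bool,
        φ (mk (MonoidAlgebra.single (FreeSemigroup.of x) 1 : FreeStarAlgebra (V ⊕ E))) =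
        ψ (mk (MonoidAlgebra.single (FreeSemigroup.of x) 1 : FreeStarAlgebra (V ⊕ E))) := by
      rintro ⟨x, _ | _⟩
      · exact hgen x
      · have hx : (MonoidAlgebra.single (FreeSemigroup.of (x, true)) 1 : FreeStarAlgebra (V ⊕ E)) =
            star (FreeStarAlgebra.of x) := by
          simp [FreeStarAlgebra.of, FreeStarAlgebra.star_single, StarWord.adjoint_of]
        rw [hx]
        have h2 : mk (star (FreeStarAlgebra.of x) : FreeStarAlgebra (V ⊕ E)) = star (gen (G := G) x) :=
          mk_star (G := G) (FreeStarAlgebra.of x : FreeStarAlgebra (V ⊕ E))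
        rw [h2, map_star, map_star, hgen]
    intro a
    induction a using FreeSemigroup.recOnMul with
    | ih1 x => exact hl x
    | ih2 x a _ ha =>
      have hx : (MonoidAlgebra.single (FreeSemigroup.of x * a) 1 : FreeStarAlgebra (V ⊕ E)) =
          MonoidAlgebra.single (FreeSemigroup.of x) 1 * MonoidAlgebra.single a 1 := by
        simp [MonoidAlgebra.single_mul_single]
      rw [hx]
      have h2 := mk_mul (G := G)
        (MonoidAlgebra.single (FreeSemigroup.of x) 1 : FreeStarAlgebra (V ⊕ E))
        (MonoidAlgebra.single a 1 : FreeStarAlgebra (V ⊕ E))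
      refine (congrArg φ h2).trans (Eq.trans ?_ (congrArg ψ h2).symm)
      rw [map_mul, map_mul, hl, ha]
  have hmk : ∀ x : FreeStarAlgebra (V ⊕ E), φ (mk x) = ψ (mk x) := by
    intro x
    induction x using MonoidAlgebra.induction_linear with
    | zero => exact (map_zero φ).trans (map_zero ψ).symm
    | add f g hf hg =>
      have h2 := mk_add (G := G) f g
      refine (congrArg φ h2).trans (Eq.trans ?_ (congrArg ψ h2).symm)
      rw [map_add, map_add, hf, hg]
    | single a c =>
      have hx : (MonoidAlgebra.single a c : FreeStarAlgebra (V ⊕ E)) =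
          c • MonoidAlgebra.single a 1 := by simp
      rw [hx]
      have h2 := mk_smul (G := G) c (MonoidAlgebra.single a 1 : FreeStarAlgebra (V ⊕ E))
      refine (congrArg φ h2).trans (Eq.trans ?_ (congrArg ψ h2).symm)
      rw [map_smul, map_smul, hword]
  have hc : ∀ χ : G.GraphCStarAlgebra →⋆ₙₐ[ℂ] B, Continuous χ := fun χ =>
    AddMonoidHomClass.continuous_of_bound χ 1 fun a => by
      simpa using NonUnitalStarAlgHom.norm_apply_le χ a
  ext a
  induction a using ind with
  | hp => exact isClosed_eq (hc φ) (hc ψ)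
  | ih x => exact hmk x

end GraphCStarAlgebra

end DirectedGraph

/-! The argument is a Hilbert hotel. Choose infinitely many edges `e_j` parallel to `α₁`, none of
them among `α₂, …, αₙ`, and put `t = p_{r(α₁)} s_{α₂} ⋯ s_{αₙ}`. In a Cuntz-Krieger family of `G`
enlarged by new edges from `s(α)` to `r(α)` indexed by `I`, the elements `s_{e_j} t` and the `s_i`,
`i ∈ I`, are partial isometries with initial projection `p_{r(α)}` and mutually orthogonal ranges
under `p_{s(α)}`. Call them `c_k`, `k ∈ ℕ ⊕ I`. Nothing in the relations distinguishes those that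
come from paths from those that come from new edges, so they may be permuted.

For an injection `τ : ℕ ⊕ I' → ℕ ⊕ I` define a family for the graph enlarged by `I'`: keep all
projections and all other edges of `G`, send a new edge `i` to `c_{τ i}`, and send `e_j` to `s_{e_j}
(p_{r(α₁)} - t t*) + c_{τ j} t*`. The relations hold (`twist`). The sum relation is void at `s(α)`,
which emits infinitely many edges, and unaffected elsewhere; this is where the infinite number of
parallel edges enters.

Since the tail edges are not altered, `t` is preserved, and the new element for `e_j` times `t` is
`c_{τ j}`: the twist reindexes the `c_k` by `τ` (`map_connecting`). Hence twisting by `τ` and by its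
inverse cancel (`map_twisted`), and a bijection `τ` induces an isomorphism of the universal
algebras. It remains to take a bijection `ℕ ⊕ ∅ ≃ ℕ ⊕ ℕ`. The edge `α₁` itself need not be one of
the `e_j`. -/

namespace DirectedGraph

variable {V : Type u} {E : Type v}

/-! ### Elementary consequences of the Cuntz-Krieger relations. -/

namespace CuntzKriegerFamily

variable {G : DirectedGraph V E} {B : Type w} [NonUnitalCStarAlgebra B]
  (S : G.CuntzKriegerFamily B)

theorem star_p (v : V) : star (S.p v) = S.p v := (S.isStarProjection v).isSelfAdjoint.star_eq

theorem p_mul_p (v : V) : S.p v * S.p v = S.p v := (S.isStarProjection v).isIdempotentElem.eq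

theorem s_mul_p (e : E) : S.s e * S.p (G.range e) = S.s e := by
  rw [← S.ck1, ← mul_assoc, S.isPartialIsometry]

theorem p_mul_s (e : E) : S.p (G.source e) * S.s e = S.s e := by
  conv_lhs => rw [← S.isPartialIsometry e]
  rw [← mul_assoc, S.ck2, S.isPartialIsometry]

/-- A Cuntz-Krieger family from relations that are convenient to check. -/
def mk' (p : V → B) (s : E → B) (isStarProjection : ∀ v, IsStarProjection (p v))
    (orthogonal : ∀ v w, v ≠ w → p v * p w = 0)
    (ck0 : ∀ e f, e ≠ f → star (s e) * s f = 0)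
    (ck1 : ∀ e, star (s e) * s e = p (G.range e))
    (hr : ∀ e, s e * p (G.range e) = s e) (hs : ∀ e, p (G.source e) * s e = s e)
    (ck3 : ∀ v, ∀ h : {e | G.source e = v}.Finite, {e | G.source e = v}.Nonempty →
      p v = ∑ e ∈ h.toFinset, s e * star (s e)) : G.CuntzKriegerFamily B where
  p := p
  s := s
  isStarProjection := isStarProjection
  orthogonal := orthogonal
  isPartialIsometry e := by rw [mul_assoc, ck1, hr]
  ck0 := ck0
  ck1 := ck1
  ck2 e := by rw [← mul_assoc, hs]
  ck3 := ck3

/-- Pulling a Cuntz-Krieger family back along an isomorphism of graphs with the same vertices. -/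
def relabel {E' : Type*} {G' : DirectedGraph V E'} (T : G'.CuntzKriegerFamily B) (σ : E ≃ E')
    (hs : ∀ e, G'.source (σ e) = G.source e) (hr : ∀ e, G'.range (σ e) = G.range e) :
    G.CuntzKriegerFamily B :=
  mk' T.p (fun e => T.s (σ e)) T.isStarProjection T.orthogonal
    (fun e f h => T.ck0 _ _ (σ.injective.ne h))
    (fun e => by rw [T.ck1, hr])
    (fun e => by rw [← hr, T.s_mul_p])
    (fun e => by rw [← hs, T.p_mul_s])
    (fun v h hn => by
      have himg : {e' | G'.source e' = v} = σ '' {e | G.source e = v} := by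
        ext e'
        simp only [Set.mem_ofPred_eq, Set.mem_image_equiv]
        rw [← hs, σ.apply_symm_apply]
      have h' : {e' | G'.source e' = v}.Finite := himg ▸ h.image σ
      rw [T.ck3 v h' (himg ▸ hn.image σ)]
      refine (Finset.sum_equiv σ (fun e => ?_) fun e _ => rfl).symm
      simp [hs])

end CuntzKriegerFamily

/-! ### Isomorphisms from the universal property. -/

namespace GraphCStarAlgebra

/-- ⋆-homomorphisms that are mutually inverse on the generators give an isomorphism. -/
theorem nonempty_starAlgEquiv {E' : Type v} {G : DirectedGraph V E} {G' : DirectedGraph V E'}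
    (φ : G.GraphCStarAlgebra →⋆ₙₐ[ℂ] G'.GraphCStarAlgebra)
    (ψ : G'.GraphCStarAlgebra →⋆ₙₐ[ℂ] G.GraphCStarAlgebra)
    (hφp : ∀ v, ψ (φ ((family G).p v)) = (family G).p v)
    (hφs : ∀ e, ψ (φ ((family G).s e)) = (family G).s e)
    (hψp : ∀ v, φ (ψ ((family G').p v)) = (family G').p v)
    (hψs : ∀ e, φ (ψ ((family G').s e)) = (family G').s e) :
    Nonempty (G.GraphCStarAlgebra ≃⋆ₐ[ℂ] G'.GraphCStarAlgebra) := by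
  have h1 : ψ.comp φ = NonUnitalStarAlgHom.id ℂ _ := hom_ext hφp hφs
  have h2 : φ.comp ψ = NonUnitalStarAlgHom.id ℂ _ := hom_ext hψp hψs
  exact ⟨{ toFun := φ, invFun := ψ
           left_inv := DFunLike.congr_fun h1, right_inv := DFunLike.congr_fun h2
           map_mul' := map_mul φ, map_add' := map_add φ
           map_star' := map_star φ, map_smul' := map_smul φ }⟩

/-- Serves to replace `G` by its enlargement by no edges, whose edge type is `E ⊕ Empty`. -/
theorem nonempty_starAlgEquiv_of_relabel {E' : Type v} {G : DirectedGraph V E}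
    {G' : DirectedGraph V E'} (σ : E ≃ E')
    (hs : ∀ e, G'.source (σ e) = G.source e) (hr : ∀ e, G'.range (σ e) = G.range e) :
    Nonempty (G.GraphCStarAlgebra ≃⋆ₐ[ℂ] G'.GraphCStarAlgebra) := by
  obtain ⟨φ, hφp, hφs⟩ := exists_lift ((family G').relabel σ hs hr)
  obtain ⟨ψ, hψp, hψs⟩ := exists_lift ((family G).relabel σ.symm
    (fun e => by rw [← hs, σ.apply_symm_apply]) (fun e => by rw [← hr, σ.apply_symm_apply]))
  refine nonempty_starAlgEquiv φ ψ (fun v => ?_) (fun e => ?_) (fun v => ?_) (fun e => ?_)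
  · rw [hφp]; exact hψp v
  · rw [hφs]; exact (hψs (σ e)).trans (congrArg (family G).s (σ.symm_apply_apply e))
  · rw [hψp]; exact hφp v
  · rw [hψs]; exact (hφs (σ.symm e)).trans (congrArg (family G').s (σ.apply_symm_apply e))

end GraphCStarAlgebra

/-! ### Enlarged graphs and the supply of parallel edges. -/

/-- The graph obtained from `G` by adding a family of edges from `s(α)` to `r(α)`, indexed by an
arbitrary type. -/
def addEdges (G : DirectedGraph V E) (α : G.Path) (I : Type*) : DirectedGraph V (E ⊕ I) where
  source := Sum.elim G.source fun _ => α.source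
  range := Sum.elim G.range fun _ => α.range

/-- The reason that the sum relations away from `s(α)` are the same for all `I`. -/
theorem addEdges_source_eq {G : DirectedGraph V E} {α : G.Path} {I : Type*} {v : V}
    (hv : v ≠ α.source) :
    {x | (G.addEdges α I).source x = v} = Sum.inl '' {f | G.source f = v} := by
  ext x
  rcases x with f | i
  · simp [addEdges]
  · simpa [addEdges] using hv.symm

/-- A sequence of distinct edges that are parallel to the first edge of the path `α` and do not
occur among its other edges. -/
structure ParallelEdges {G : DirectedGraph V E} (α : G.Path) where
  edge : ℕ → E
  injective : Function.Injective edge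
  source_eq : ∀ j, G.source (edge j) = G.source α.first
  range_eq : ∀ j, G.range (edge j) = G.range α.first
  ne_tail : ∀ j (i : Fin α.length), α.edge i.succ ≠ edge j

/-! ### The tail of the path and the connecting partial isometries. -/

namespace CuntzKriegerFamily

variable {G : DirectedGraph V E} {α : G.Path} {I I' : Type*} {B : Type w}
  [NonUnitalCStarAlgebra B] (S : (G.addEdges α I).CuntzKriegerFamily B)

/-- The element `p_{r(α₁)} s_{α₂} ⋯ s_{αᵢ₊₁}`. -/
def tailUpTo : Fin (α.length + 1) → B :=
  -- The projection replaces the empty product, as there is no unit. For a path of one edge the tail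
  -- is this projection and `gap` vanishes.
  Fin.induction (S.p (G.range α.first)) fun i x => x * S.s (Sum.inl (α.edge i.succ))

theorem tailUpTo_zero : S.tailUpTo 0 = S.p (G.range α.first) := rfl

theorem tailUpTo_succ (i : Fin α.length) :
    S.tailUpTo i.succ = S.tailUpTo i.castSucc * S.s (Sum.inl (α.edge i.succ)) := rfl

/-- The product collapses from the inside: the projection obtained so far sits at the source of the
next edge, which absorbs it. -/
theorem star_tailUpTo_mul_self (i : Fin (α.length + 1)) :
    star (S.tailUpTo i) * S.tailUpTo i = S.p (G.range (α.edge i)) := by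
  induction i using Fin.induction with
  | zero => rw [tailUpTo_zero, star_p, p_mul_p]; rfl
  | succ i ih =>
    rw [tailUpTo_succ, star_mul, mul_assoc, ← mul_assoc (star (S.tailUpTo _)), ih,
      α.range_eq_source]
    have h := S.p_mul_s (Sum.inl (α.edge i.succ))
    change S.p (G.source _) * _ = _ at h
    rw [h]
    exact S.ck1 (Sum.inl (α.edge i.succ))

theorem tailUpTo_mul_p (i : Fin (α.length + 1)) :
    S.tailUpTo i * S.p (G.range (α.edge i)) = S.tailUpTo i := by
  induction i using Fin.induction with
  | zero => exact S.p_mul_p _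
  | succ i _ =>
    rw [tailUpTo_succ, mul_assoc]
    exact congrArg _ (S.s_mul_p (Sum.inl (α.edge i.succ)))

theorem p_mul_tailUpTo (i : Fin (α.length + 1)) :
    S.p (G.range α.first) * S.tailUpTo i = S.tailUpTo i := by
  induction i using Fin.induction with
  | zero => exact S.p_mul_p _
  | succ i ih => rw [tailUpTo_succ, ← mul_assoc, ih]

/-- The element `p_{r(α₁)} s_{α₂} ⋯ s_{αₙ}`. -/
def tail : B := S.tailUpTo (Fin.last α.length)

theorem star_tail_mul_tail : star S.tail * S.tail = S.p α.range := S.star_tailUpTo_mul_self _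

theorem tail_mul_p : S.tail * S.p α.range = S.tail := S.tailUpTo_mul_p _

theorem p_mul_tail : S.p (G.range α.first) * S.tail = S.tail := S.p_mul_tailUpTo _

theorem star_tail_mul_p : star S.tail * S.p (G.range α.first) = star S.tail := by
  rw [← S.star_p, ← star_mul, p_mul_tail]

/-- The part of `p_{r(α₁)}` that is orthogonal to the range of `tail`. -/
def gap : B := S.p (G.range α.first) - S.tail * star S.tail

theorem star_gap : star S.gap = S.gap := by simp [gap, star_p]

theorem gap_mul_tail : S.gap * S.tail = 0 := by
  rw [gap, sub_mul, p_mul_tail, mul_assoc, star_tail_mul_tail, tail_mul_p, sub_self]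

theorem star_tail_mul_gap : star S.tail * S.gap = 0 := by
  rw [← S.star_gap, ← star_mul, gap_mul_tail, star_zero]

theorem gap_mul_p : S.gap * S.p (G.range α.first) = S.gap := by
  rw [gap, sub_mul, p_mul_p, mul_assoc, star_tail_mul_p]

theorem gap_mul_gap : S.gap * S.gap = S.gap := by
  nth_rw 2 [gap]
  rw [mul_sub, gap_mul_p, ← mul_assoc, gap_mul_tail, zero_mul, sub_zero]

theorem gap_add : S.gap + S.tail * star S.tail = S.p (G.range α.first) := by simp [gap]

variable (F : ParallelEdges α)

/-- The partial isometries from `r(α)` to `s(α)` that are given by the parallel edges followed by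
the tail of `α`, and by the new edges. -/
def connecting : ℕ ⊕ I → B :=
  Sum.elim (fun j => S.s (Sum.inl (F.edge j)) * S.tail) fun i => S.s (Sum.inr i)

theorem s_edge_mul_p (j : ℕ) :
    S.s (Sum.inl (F.edge j)) * S.p (G.range α.first) = S.s (Sum.inl (F.edge j)) := by
  rw [← F.range_eq j]; exact S.s_mul_p (Sum.inl (F.edge j))

theorem p_mul_s_edge (j : ℕ) :
    S.p α.source * S.s (Sum.inl (F.edge j)) = S.s (Sum.inl (F.edge j)) := by
  have h := S.p_mul_s (Sum.inl (F.edge j))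
  change S.p (G.source _) * _ = _ at h
  rwa [F.source_eq j] at h

theorem star_s_edge_mul_self (j : ℕ) :
    star (S.s (Sum.inl (F.edge j))) * S.s (Sum.inl (F.edge j)) = S.p (G.range α.first) := by
  rw [← F.range_eq j]; exact S.ck1 (Sum.inl (F.edge j))

theorem star_s_edge_mul_of_ne {j k : ℕ} (h : j ≠ k) :
    star (S.s (Sum.inl (F.edge j))) * S.s (Sum.inl (F.edge k)) = 0 :=
  S.ck0 _ _ (by simpa using F.injective.ne h)

theorem star_s_mul_connecting {f : E} (hf : ∀ j, F.edge j ≠ f) (k : ℕ ⊕ I) :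
    star (S.s (Sum.inl f)) * S.connecting F k = 0 := by
  rcases k with j | i
  · simp only [connecting, Sum.elim_inl]
    rw [← mul_assoc, S.ck0 _ _ (by simpa using (hf j).symm), zero_mul]
  · exact S.ck0 _ _ (by simp)

/-- A connecting element either has range orthogonal to that of the parallel edge `j`, or is this
edge followed by the tail. In the latter case stripping the edge leaves the tail, which `gap`
annihilates. -/
theorem gap_mul_star_s_edge_mul_connecting (j : ℕ) (k : ℕ ⊕ I) :
    S.gap * (star (S.s (Sum.inl (F.edge j))) * S.connecting F k) = 0 := by
  rcases k with l | i
  · simp only [connecting, Sum.elim_inl]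
    rw [← mul_assoc (star _)]
    rcases eq_or_ne j l with rfl | h
    · rw [star_s_edge_mul_self, p_mul_tail, gap_mul_tail]
    · rw [star_s_edge_mul_of_ne S F h, zero_mul, mul_zero]
  · simp only [connecting, Sum.elim_inr]
    rw [S.ck0 _ _ (by simp), mul_zero]

theorem star_connecting_mul_self (k : ℕ ⊕ I) :
    star (S.connecting F k) * S.connecting F k = S.p α.range := by
  rcases k with j | i
  · simp only [connecting, Sum.elim_inl]
    rw [star_mul, mul_assoc, ← mul_assoc (star (S.s _)), star_s_edge_mul_self, p_mul_tail,
      star_tail_mul_tail]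
  · exact S.ck1 (Sum.inr i)

/-- Distinct connecting elements begin with distinct edges. -/
theorem star_connecting_mul_of_ne {k l : ℕ ⊕ I} (h : k ≠ l) :
    star (S.connecting F k) * S.connecting F l = 0 := by
  rcases k with j | i <;> rcases l with j' | i' <;>
    simp only [connecting, Sum.elim_inl, Sum.elim_inr, star_mul]
  · rw [mul_assoc, ← mul_assoc (star (S.s _)),
      star_s_edge_mul_of_ne S F (by simpa using h), zero_mul, mul_zero]
  · rw [mul_assoc, S.ck0 _ _ (by simp), mul_zero]
  · rw [← mul_assoc, S.ck0 _ _ (by simp), zero_mul]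
  · exact S.ck0 _ _ (by simpa using h)

theorem connecting_mul_p (k : ℕ ⊕ I) :
    S.connecting F k * S.p α.range = S.connecting F k := by
  rcases k with j | i
  · simp only [connecting, Sum.elim_inl]
    rw [mul_assoc, tail_mul_p]
  · exact S.s_mul_p (Sum.inr i)

theorem p_mul_connecting (k : ℕ ⊕ I) :
    S.p α.source * S.connecting F k = S.connecting F k := by
  rcases k with j | i
  · simp only [connecting, Sum.elim_inl]
    rw [← mul_assoc, p_mul_s_edge]
  · exact S.p_mul_s (Sum.inr i)

/-! ### The twisted family. -/

variable (τ : ℕ ⊕ I' → ℕ ⊕ I)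

/-- The partial isometry for a parallel edge, in which the part that passes through the tail of `α`
is replaced according to `τ`. -/
def twistedEdge (j : ℕ) : B :=
  S.s (Sum.inl (F.edge j)) * S.gap + S.connecting F (τ (Sum.inl j)) * star S.tail

/-- The partial isometries of the twisted family. -/
noncomputable def twisted : E ⊕ I' → B :=
  Sum.elim (Function.extend F.edge (S.twistedEdge F τ) fun f => S.s (Sum.inl f))
    fun i => S.connecting F (τ (Sum.inr i))

theorem twisted_edge (j : ℕ) : S.twisted F τ (Sum.inl (F.edge j)) = S.twistedEdge F τ j := by
  rw [twisted, Sum.elim_inl, F.injective.extend_apply]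

theorem twisted_inl {f : E} (hf : ∀ j, F.edge j ≠ f) :
    S.twisted F τ (Sum.inl f) = S.s (Sum.inl f) := by
  rw [twisted, Sum.elim_inl, Function.extend_apply' _ _ _ (by simpa using hf)]

theorem twisted_inr (i : I') : S.twisted F τ (Sum.inr i) = S.connecting F (τ (Sum.inr i)) := rfl

/-- The defining feature of the twist: following the modified parallel edge by the tail gives the
connecting element selected by `τ`. -/
theorem twistedEdge_mul_tail (j : ℕ) :
    S.twistedEdge F τ j * S.tail = S.connecting F (τ (Sum.inl j)) := by
  rw [twistedEdge, add_mul, mul_assoc, gap_mul_tail, mul_zero, zero_add, mul_assoc,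
    star_tail_mul_tail, connecting_mul_p]

theorem star_s_mul_twistedEdge {f : E} (hf : ∀ j, F.edge j ≠ f) (j : ℕ) :
    star (S.s (Sum.inl f)) * S.twistedEdge F τ j = 0 := by
  rw [twistedEdge, mul_add, ← mul_assoc, ← mul_assoc, star_s_mul_connecting S F hf,
    S.ck0 _ _ (by simpa using (hf j).symm), zero_mul, zero_mul, add_zero]

theorem star_twistedEdge_mul_connecting (j : ℕ) (k : ℕ ⊕ I) :
    star (S.twistedEdge F τ j) * S.connecting F k =
      S.tail * (star (S.connecting F (τ (Sum.inl j))) * S.connecting F k) := by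
  rw [twistedEdge, star_add, star_mul, star_mul, star_star, star_gap, add_mul, mul_assoc,
    gap_mul_star_s_edge_mul_connecting, zero_add, mul_assoc]

theorem star_connecting_mul_s_edge_mul_gap (j : ℕ) (k : ℕ ⊕ I) :
    star (S.connecting F k) * (S.s (Sum.inl (F.edge j)) * S.gap) = 0 := by
  have h := congrArg star (S.gap_mul_star_s_edge_mul_connecting F j k)
  simpa [star_gap, mul_assoc] using h

/-- The mixed terms vanish: the range of the part of an edge supported on `gap` is orthogonal to
every connecting element. -/
theorem star_twistedEdge_mul_twistedEdge (j l : ℕ) :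
    star (S.twistedEdge F τ j) * S.twistedEdge F τ l =
      S.gap * (star (S.s (Sum.inl (F.edge j))) * S.s (Sum.inl (F.edge l))) * S.gap +
      S.tail * (star (S.connecting F (τ (Sum.inl j))) * S.connecting F (τ (Sum.inl l))) *
        star S.tail := by
  conv_lhs => enter [2]; rw [twistedEdge]
  rw [mul_add, ← mul_assoc _ (S.connecting F _), star_twistedEdge_mul_connecting]
  congr 1
  rw [twistedEdge, star_add, star_mul, star_mul, star_star, star_gap, add_mul, mul_assoc S.tail,
    star_connecting_mul_s_edge_mul_gap, mul_zero, add_zero]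
  simp only [mul_assoc]

/-- The two summands have initial projections `gap` and `tail * star tail`, which add up to
`p_{r(α₁)}`. -/
theorem star_twistedEdge_mul_self (j : ℕ) :
    star (S.twistedEdge F τ j) * S.twistedEdge F τ j = S.p (G.range α.first) := by
  rw [star_twistedEdge_mul_twistedEdge, star_s_edge_mul_self, star_connecting_mul_self, gap_mul_p,
    gap_mul_gap, tail_mul_p, gap_add]

theorem twistedEdge_mul_p (j : ℕ) :
    S.twistedEdge F τ j * S.p (G.range α.first) = S.twistedEdge F τ j := by
  rw [twistedEdge, add_mul, mul_assoc, mul_assoc, gap_mul_p, star_tail_mul_p]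

theorem p_mul_twistedEdge (j : ℕ) :
    S.p α.source * S.twistedEdge F τ j = S.twistedEdge F τ j := by
  rw [twistedEdge, mul_add, ← mul_assoc, ← mul_assoc, p_mul_s_edge, p_mul_connecting]

/-- Every edge of the enlarged graph is parallel, or another edge of `G`, or new. -/
theorem _root_.DirectedGraph.ParallelEdges.cases {motive : E ⊕ I' → Prop}
    (F : ParallelEdges α) (edge : ∀ j, motive (Sum.inl (F.edge j)))
    (inl : ∀ f, (∀ j, F.edge j ≠ f) → motive (Sum.inl f)) (inr : ∀ i, motive (Sum.inr i))
    (x : E ⊕ I') : motive x := by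
  rcases x with f | i
  · by_cases hf : ∀ j, F.edge j ≠ f
    · exact inl f hf
    · push Not at hf
      obtain ⟨j, rfl⟩ := hf
      exact edge j
  · exact inr i

/-- Injectivity of `τ` ensures that no connecting element is used twice. The remaining cases reduce
to orthogonality of distinct edges of the original family. -/
theorem star_twisted_mul_of_ne (hτ : Function.Injective τ) (x y : E ⊕ I') (h : x ≠ y) :
    star (S.twisted F τ x) * S.twisted F τ y = 0 := by
  have flip : ∀ {a b : B}, star a * b = 0 → star b * a = 0 := fun {a b} h => by
    simpa using congrArg star h
  induction x using F.cases with
  | edge j =>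
    rw [twisted_edge]
    induction y using F.cases with
    | edge l =>
      have hjl : j ≠ l := fun hjl => h (by rw [hjl])
      rw [twisted_edge, star_twistedEdge_mul_twistedEdge, star_s_edge_mul_of_ne S F hjl,
        star_connecting_mul_of_ne S F (hτ.ne (by simpa using hjl))]
      simp
    | inl f hf =>
      rw [twisted_inl S F τ hf]
      exact flip (star_s_mul_twistedEdge S F τ hf j)
    | inr i =>
      rw [twisted_inr, star_twistedEdge_mul_connecting,
        star_connecting_mul_of_ne S F (hτ.ne (by simp)), mul_zero]
  | inl f hf =>
    rw [twisted_inl S F τ hf]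
    induction y using F.cases with
    | edge l => rw [twisted_edge]; exact star_s_mul_twistedEdge S F τ hf l
    | inl g hg =>
      rw [twisted_inl S F τ hg]
      exact S.ck0 _ _ (by simpa using h)
    | inr i => exact star_s_mul_connecting S F hf _
  | inr i =>
    rw [twisted_inr]
    induction y using F.cases with
    | edge l =>
      rw [twisted_edge]
      refine flip ?_
      rw [star_twistedEdge_mul_connecting, star_connecting_mul_of_ne S F (hτ.ne (by simp)),
        mul_zero]
    | inl f hf => rw [twisted_inl S F τ hf]; exact flip (star_s_mul_connecting S F hf _)
    | inr i' => exact star_connecting_mul_of_ne S F (hτ.ne (by simpa using h))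

/-- The twisted Cuntz-Krieger family. -/
noncomputable def twist (hτ : Function.Injective τ) : (G.addEdges α I').CuntzKriegerFamily B :=
  mk' S.p (S.twisted F τ) S.isStarProjection S.orthogonal (S.star_twisted_mul_of_ne F τ hτ)
    (F.cases (fun j => by
        rw [twisted_edge, star_twistedEdge_mul_self, ← F.range_eq j]; rfl)
      (fun f hf => by rw [twisted_inl S F τ hf]; exact S.ck1 (Sum.inl f))
      (fun i => S.star_connecting_mul_self F _))
    (F.cases (fun j => by
        rw [twisted_edge]
        change _ * S.p (G.range _) = _
        rw [F.range_eq j, twistedEdge_mul_p])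
      (fun f hf => by rw [twisted_inl S F τ hf]; exact S.s_mul_p (Sum.inl f))
      (fun i => S.connecting_mul_p F _))
    (F.cases (fun j => by
        rw [twisted_edge]
        change S.p (G.source _) * _ = _
        rw [F.source_eq j]
        exact S.p_mul_twistedEdge F τ j)
      (fun f hf => by rw [twisted_inl S F τ hf]; exact S.p_mul_s (Sum.inl f))
      (fun i => S.p_mul_connecting F _))
    (fun v h hn => by
      -- The parallel edges make `s(α)` an infinite emitter, so the relation is never imposed there.
      have hv : v ≠ α.source := by
        rintro rfl
        refine Set.infinite_of_injective_forall_mem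
          (Sum.inl_injective.comp F.injective) (fun j => ?_) h
        exact F.source_eq j
      have key := addEdges_source_eq (I := I) hv
      have key' := addEdges_source_eq (I := I') hv
      have hfin : {f | G.source f = v}.Finite := by
        rw [key'] at h
        exact h.of_finite_image Sum.inl_injective.injOn
      have h0 : {x | (G.addEdges α I).source x = v}.Finite := key ▸ hfin.image _
      have hn0 : {x | (G.addEdges α I).source x = v}.Nonempty := by
        rw [key', Set.image_nonempty] at hn
        exact key ▸ hn.image _
      have e0 : h0.toFinset = hfin.toFinset.map Function.Embedding.inl := by
        ext x; simpa using Set.ext_iff.1 (key) x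
      have e1 : h.toFinset = hfin.toFinset.map Function.Embedding.inl := by
        ext x; simpa using Set.ext_iff.1 key' x
      rw [S.ck3 v h0 hn0, e0, e1, Finset.sum_map, Finset.sum_map]
      refine Finset.sum_congr rfl fun f hf => ?_
      -- Parallel edges start at `s(α)`, hence the edges out of `v` are left alone by the twist.
      have hne : ∀ j, F.edge j ≠ f := fun j hj => hv <| by
        rw [← (by simpa using hf : G.source f = v), ← hj]
        exact F.source_eq j
      exact (congrArg (fun b => b * star b) (S.twisted_inl F τ hne)).symm)

/-! ### Inverting the twist. -/

/-- If a ⋆-homomorphism carries `T` to the twist of `S`, then it carries the tail to the tail. -/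
theorem map_tail {C : Type*} [NonUnitalCStarAlgebra C]
    (T : (G.addEdges α I').CuntzKriegerFamily C) (φ : C →⋆ₙₐ[ℂ] B)
    (hp : ∀ v, φ (T.p v) = S.p v) (hs : ∀ x, φ (T.s x) = S.twisted F τ x) :
    φ T.tail = S.tail := by
  suffices h : ∀ i, φ (T.tailUpTo i) = S.tailUpTo i from h _
  intro i
  induction i using Fin.induction with
  | zero => exact hp _
  | succ i ih =>
    -- A tail edge could itself be parallel to `α₁`; the condition `ne_tail` guarantees that it is
    -- not among the modified ones.
    rw [tailUpTo_succ, tailUpTo_succ, map_mul, ih, hs,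
      twisted_inl S F τ fun j => (F.ne_tail j i).symm]

/-- On connecting elements the twist is mere reindexing by `τ`, so twists compose as maps of index
sets do. -/
theorem map_connecting {C : Type*} [NonUnitalCStarAlgebra C]
    (T : (G.addEdges α I').CuntzKriegerFamily C) (φ : C →⋆ₙₐ[ℂ] B)
    (hp : ∀ v, φ (T.p v) = S.p v) (hs : ∀ x, φ (T.s x) = S.twisted F τ x) (k : ℕ ⊕ I') :
    φ (T.connecting F k) = S.connecting F (τ k) := by
  rcases k with j | i
  · change φ (T.s _ * T.tail) = _
    rw [map_mul, hs, twisted_edge, S.map_tail F τ T φ hp hs, twistedEdge_mul_tail]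
  · exact hs (Sum.inr i)

/-- Twisting along `τ` undoes twisting along a left inverse of `τ`. -/
theorem map_twisted {C : Type*} [NonUnitalCStarAlgebra C]
    (T : (G.addEdges α I').CuntzKriegerFamily C) (φ : C →⋆ₙₐ[ℂ] B)
    (hp : ∀ v, φ (T.p v) = S.p v) (hs : ∀ x, φ (T.s x) = S.twisted F τ x)
    (ρ : ℕ ⊕ I → ℕ ⊕ I') (hρ : ∀ k, τ (ρ k) = k) (x : E ⊕ I) :
    φ (T.twisted F ρ x) = S.s x := by
  induction x using F.cases with
  | edge j =>
    rw [twisted_edge, twistedEdge, gap, map_add, map_mul, map_mul, map_sub, map_mul, map_star, hp,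
      hs, twisted_edge, S.map_tail F τ T φ hp hs, S.map_connecting F τ T φ hp hs, hρ, ← gap]
    -- With `s` the parallel edge and `t` the tail, the image is now the twisted edge times `gap`,
    -- plus `s t t*`. The correction inside the twisted edge dies because `t* gap = 0`, and what is
    -- left is `s (gap + t t*) = s`.
    change _ + S.s (Sum.inl (F.edge j)) * S.tail * star S.tail = _
    rw [twistedEdge, add_mul, mul_assoc, gap_mul_gap, mul_assoc, star_tail_mul_gap, mul_zero,
      add_zero, mul_assoc, ← mul_add, gap_add, s_edge_mul_p]
  | inl f hf => rw [twisted_inl T F ρ hf, hs, twisted_inl S F τ hf]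
  | inr i => rw [twisted_inr, S.map_connecting F τ T φ hp hs, hρ]; rfl

end CuntzKriegerFamily

/-! ### The isomorphism. -/

/-- The twists along `τ` and `τ.symm` induce mutually inverse homomorphisms. Taking `I` and `I'` in
`Type` keeps both edge types in the universe of `E`, so that each algebra is a legitimate target for
the universal property of the other. -/
theorem ParallelEdges.nonempty_starAlgEquiv {G : DirectedGraph V E} {α : G.Path}
    (F : ParallelEdges α) {I I' : Type} (τ : ℕ ⊕ I' ≃ ℕ ⊕ I) :
    Nonempty ((G.addEdges α I').GraphCStarAlgebra ≃⋆ₐ[ℂ]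
      (G.addEdges α I).GraphCStarAlgebra) := by
  let S := GraphCStarAlgebra.family (G.addEdges α I)
  let T := GraphCStarAlgebra.family (G.addEdges α I')
  obtain ⟨φ, hφp, hφs⟩ := GraphCStarAlgebra.exists_lift (S.twist F τ τ.injective)
  obtain ⟨ψ, hψp, hψs⟩ := GraphCStarAlgebra.exists_lift (T.twist F τ.symm τ.symm.injective)
  refine GraphCStarAlgebra.nonempty_starAlgEquiv φ ψ (fun v => ?_) (fun e => ?_) (fun v => ?_)
    (fun e => ?_)
  · rw [hφp]; exact hψp v
  · rw [hφs]
    exact T.map_twisted F τ.symm S ψ hψp hψs τ τ.symm_apply_apply e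
  · rw [hψp]; exact hφp v
  · rw [hψs]
    exact S.map_twisted F τ T φ hφp hφs τ.symm τ.apply_symm_apply e

theorem ParallelEdges.nonempty_of_infinite {G : DirectedGraph V E} {α : G.Path}
    (h : {e : E | G.source e = G.source α.first ∧ G.range e = G.range α.first}.Infinite) :
    Nonempty (ParallelEdges α) := by
  -- Only finitely many edges occur in the tail, so discarding them leaves an infinite set.
  have h' := h.sdiff (Set.finite_range fun i : Fin α.length => α.edge i.succ)
  let g := h'.natEmbedding
  exact ⟨{ edge := fun j => g j
           injective := Subtype.val_injective.comp g.injective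
           source_eq := fun j => (g j).2.1.1
           range_eq := fun j => (g j).2.1.2
           ne_tail := fun j i hi => (g j).2.2 ⟨i, hi⟩ }⟩

end DirectedGraph

theorem mainTheorem3 {V : Type u} {E : Type v} (G : DirectedGraph V E) (α : G.Path)
    (h : {e : E | G.source e = G.source α.first ∧ G.range e = G.range α.first}.Infinite) :
    Nonempty (G.GraphCStarAlgebra ≃⋆ₐ[ℂ] (G.addPathEdges α).GraphCStarAlgebra) := by
  obtain ⟨F⟩ := DirectedGraph.ParallelEdges.nonempty_of_infinite h
  -- The Hilbert hotel: the parallel edges alone are matched with the parallel edges together with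
  -- the new edges `αᵐ`. The target `addEdges α ℕ` agrees with `addPathEdges α` by definition.
  obtain ⟨Φ⟩ := F.nonempty_starAlgEquiv
    ((Equiv.sumEmpty ℕ Empty).trans Equiv.natSumNatEquivNat.symm : ℕ ⊕ Empty ≃ ℕ ⊕ ℕ)
  obtain ⟨Ψ⟩ := DirectedGraph.GraphCStarAlgebra.nonempty_starAlgEquiv_of_relabel (G := G)
    (G' := G.addEdges α Empty) (Equiv.sumEmpty E Empty).symm (fun _ => rfl) (fun _ => rfl)
  exact ⟨Ψ.trans Φ⟩
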